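/- Let $q$ be a prime power and $0<u<q^{1/2}$. For a partition $\lambda$ let $m_i(\lambda)$ be the number of parts equal to $i$, $\lambda_i'=m_i(\lambda)+m_{i+1}(\lambda)+\cdots$ the parts of the dual partition, $|\lambda|$ the size, $l(\lambda)=\lambda_1'$ the number of parts, $o(\lambda)$ the number of odd parts and $n(\lambda)=\sum_i\binom{\lambda_i'}{2}$. Put \[ C=\prod_{i\ge 1}\bigl(1-u^2/q^{2i-1}\bigr),\qquad W(\lambda)=\frac{q^{l(\lambda)}u^{|\lambda|}}{q^{n(\lambda)+\frac{|\lambda|}{2}+\frac{o(\lambda)}{2}}\prod_{i}(1-1/q^2)(1-1/q^4)\cdots(1-1/q^{2\lfloor m_i(\lambda)/2\rfloor})}. \] The measure $R^e_{(u,q)}$ (respectively $R^o_{(u,q)}$) on the set of all partitions $\lambda$ is given by $R^e_{(u,q)}(\lambda)=C\,W(\lambda)$ (respectively $R^o_{(u,q)}(\lambda)=u^{-2}\,C\,W(\lambda)$) if all odd parts of $\lambda$ have even multiplicity and the number of parts of $\lambda$ is even (respectively odd), and by $0$ otherwise. For $k\ge 0$ put \[ D_{2k}=\prod_{i=1}^{k}(1-u^2/q^{2i-1})(1-1/q^{2i}),\qquad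 D_{2k+1}=D_{2k}\,(1-u^2/q^{2k+1}), \] \[ P'_{Sp,u}(2k)=\frac{u^{2k}}{q^{2k^2+k}D_{2k}},\quad P'_{Sp,u}(2k+1)=\frac{u^{2k+2}}{q^{2k^2+3k+1}D_{2k+1}},\quad P'_{O,u}(2k)=\frac{u^{2k}}{q^{2k^2-k}D_{2k}},\quad P'_{O,u}(2k+1)=\frac{u^{2k+1}}{q^{2k^2+k}D_{2k+1}}. \] For natural numbers $a,b$ (including $0$) define \[ K_1(a,b)=\frac{u^aP'_{O,u}(b)}{P'_{Sp,u}(a)\,q^{\frac{a^2-b^2+2(a+1)b}{4}}(q^{a-b}-1)\cdots(q^4-1)(q^2-1)}\quad\text{if } b\le a \text{ and } a-b \text{ is even}, \] and $K_1(a,b)=0$ otherwise; \[ K_2(a,b)=\frac{u^aP'_{Sp,u}(b)\,q^{(a-b)^2/4}}{P'_{O,u}(a)\,q^{\frac{a^2+b}{2}-a}(q^{a-b}-1)\cdots(q^4-1)(q^2-1)}\quad\text{if } b\le a \text{ and } a-b \text{ is even}, \] \[ K_2(a,b)=\frac{u^aP'_{Sp,u}(b)\,q^{((a-b)^2-1)/4}}{P'_{O,u}(a)\,q^{\frac{a^2-a}{2}}(q^{a-b-1}-1)\cdots(q^4-1)(q^2-1)}\quad\text{if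 } b\le a \text{ and } a-b \text{ is odd}, \] and $K_2(a,b)=0$ otherwise. Empty products are $1$. Then $K_1$ and $K_2$ are transition probabilities on the natural numbers (they are nonnegative, and $\sum_b K_j(a,b)=1$ for every $a$), the starting laws in (1) and (2) below are probability distributions, and the following hold. (1) Let $\lambda_1'$ be a random even natural number which is equal to $2k$ with probability \[ C\cdot\frac{u^{2k}}{q^{2k^2-k}D_{2k}}\qquad(k\ge 0). \] Define $\lambda_2',\lambda_3',\dots$ successively by the rule that, given $\lambda_1',\dots,\lambda_i'$ with $\lambda_i'=a$, one has $\lambda_{i+1}'=b$ with probability $K_1(a,b)$ if $i$ is odd and with probability $K_2(a,b)$ if $i$ is even. Then almost surely $\lambda_1',\lambda_2',\dots$ are the parts of the dual of a partition $\lambda$, and this random partition $\lambda$ is distributed according to $R^e_{(u,q)}$. (2) Let $\lambda_1'$ be a random odd natural number which is equal to $2k+1$ with probability \[ C\cdot\frac{u^{2k}}{q^{2k^2+k}D_{2k+1}}\qquad(k\ge 0), \] and define $\lambda_2',\lambda_3',\dots$ by the same rule as in (1). Then almost surely $\lambda_1',\lambda_2',\dots$ are the parts of the dual of a partition $\lambda$,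 and this random partition $\lambda$ is distributed according to $R^o_{(u,q)}$. -/

import Mathlib

/-! Partitions are Young diagrams `μ`: the list of parts is `μ.rowLens` (weakly decreasing, positive),
the size `|μ|` is `μ.card`, and the dual parts are `μ'_{j+1} = μ.colLen j` for `j : ℕ`. -/

namespace RandomPartition

noncomputable section

/-- The multiplicity `m_i(μ)` of `i` as a part of `μ`. -/
def mult (μ : YoungDiagram) (i : ℕ) : ℕ := μ.rowLens.count i

/-- The number `l(μ)` of parts. -/
def numParts (μ : YoungDiagram) : ℕ := μ.rowLens.length

/-- The number `o(μ)` of odd parts, counted with multiplicity. -/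
def numOddParts (μ : YoungDiagram) : ℕ := μ.rowLens.countP (fun p => decide (Odd p))

/-- `n(μ) = ∑_j (μ'_j choose 2)`; the columns after the first `μ.rowLen 0` ones are empty. -/
def nStat (μ : YoungDiagram) : ℕ := ∑ j ∈ Finset.range (μ.rowLen 0), (μ.colLen j).choose 2

/-- All odd parts of `μ` occur with even multiplicity. -/
def OddPartsEvenMult (μ : YoungDiagram) : Prop := ∀ i, Odd i → Even (mult μ i)

/-- The infinite product `∏_{i ≥ 1} (1 - u^2 / q^(2i-1))`. -/
def eulerProd (u q : ℝ) : ℝ := ∏' i : ℕ, (1 - u ^ 2 / q ^ (2 * i + 1))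

/-- The infinite product converges, so that `eulerProd` is not a default value. -/
theorem multipliable_eulerProd (u q : ℝ) (hq : 1 < q) :
    Multipliable (fun i : ℕ => 1 - u ^ 2 / q ^ (2 * i + 1)) := by
  have hq0 : 0 < q := by linarith
  have hs : Summable (fun i : ℕ => -(u ^ 2 / q ^ (2 * i + 1))) := by
    have h1 : Summable (fun i : ℕ => (1 / q ^ 2) ^ i) :=
      summable_geometric_of_lt_one (by positivity)
        (by rw [div_lt_one (by positivity)]; nlinarith)
    refine (h1.mul_left (-(u ^ 2 / q))).congr fun i => ?_
    rw [pow_succ q (2 * i), pow_mul, one_div, inv_pow]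
    field_simp
  simpa [sub_eq_add_neg] using Real.multipliable_one_add_of_summable hs

/-- The unnormalized weight
`q^l u^|μ| / (q^(n + |μ|/2 + o/2) ∏_i (1 - 1/q^2)(1 - 1/q^4) ⋯ (1 - 1/q^(2⌊m_i/2⌋)))`. -/
def weight (u q : ℝ) (μ : YoungDiagram) : ℝ :=
  q ^ numParts μ * u ^ μ.card /
    (q ^ ((nStat μ : ℝ) + (μ.card : ℝ) / 2 + (numOddParts μ : ℝ) / 2) *
      ∏ i ∈ Finset.Icc 1 (μ.rowLen 0), ∏ j ∈ Finset.Icc 1 (mult μ i / 2), (1 - 1 / q ^ (2 * j)))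

open Classical in
/-- The measure `R^e_{(u,q)}`, as a mass function on all partitions (zero off its support). -/
def Re (u q : ℝ) (μ : YoungDiagram) : ℝ :=
  if Even (numParts μ) ∧ OddPartsEvenMult μ then eulerProd u q * weight u q μ else 0

open Classical in
/-- The measure `R^o_{(u,q)}`, as a mass function on all partitions (zero off its support). -/
def Ro (u q : ℝ) (μ : YoungDiagram) : ℝ :=
  if Odd (numParts μ) ∧ OddPartsEvenMult μ then 1 / u ^ 2 * eulerProd u q * weight u q μ else 0

/-- `(1 - u^2/q)(1 - 1/q^2) ⋯ (1 - u^2/q^(2k-1))(1 - 1/q^(2k))`. -/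
def denomEven (u q : ℝ) (k : ℕ) : ℝ :=
  ∏ i ∈ Finset.Icc 1 k, ((1 - u ^ 2 / q ^ (2 * i - 1)) * (1 - 1 / q ^ (2 * i)))

/-- `(1 - u^2/q)(1 - 1/q^2) ⋯ (1 - 1/q^(2k))(1 - u^2/q^(2k+1))`. -/
def denomOdd (u q : ℝ) (k : ℕ) : ℝ := denomEven u q k * (1 - u ^ 2 / q ^ (2 * k + 1))

/-- `P'_{Sp,u}(a)`; here `a / 2` is `k` both for `a = 2k` and for `a = 2k+1`. -/
def PSp (u q : ℝ) (a : ℕ) : ℝ :=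
  let k := a / 2
  if Even a then u ^ (2 * k) / (q ^ (2 * k ^ 2 + k) * denomEven u q k)
  else u ^ (2 * k + 2) / (q ^ (2 * k ^ 2 + 3 * k + 1) * denomOdd u q k)

/-- `P'_{O,u}(a)`; here `a / 2` is `k` both for `a = 2k` and for `a = 2k+1`. -/
def PO (u q : ℝ) (a : ℕ) : ℝ :=
  let k := a / 2
  if Even a then u ^ (2 * k) / (q ^ (2 * (k : ℤ) ^ 2 - (k : ℤ)) * denomEven u q k)
  else u ^ (2 * k + 1) / (q ^ (2 * k ^ 2 + k) * denomOdd u q k)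

/-- `(q^m - 1)(q^(m-2) - 1) ⋯ (q^2 - 1)`, for even `m`. -/
def evenProd (q : ℝ) (m : ℕ) : ℝ := ∏ j ∈ Finset.Icc 1 (m / 2), (q ^ (2 * j) - 1)

/-- The transition probabilities `K_1(a,b)`. -/
def K₁ (u q : ℝ) (a b : ℕ) : ℝ :=
  if b ≤ a ∧ Even (a - b) then
    u ^ a * PO u q b /
      (PSp u q a * q ^ (((a : ℝ) ^ 2 - (b : ℝ) ^ 2 + 2 * ((a : ℝ) + 1) * (b : ℝ)) / 4) *
        evenProd q (a - b))
  else 0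

/-- The transition probabilities `K_2(a,b)`. -/
def K₂ (u q : ℝ) (a b : ℕ) : ℝ :=
  if b ≤ a ∧ Even (a - b) then
    u ^ a * PSp u q b * q ^ (((a : ℝ) - (b : ℝ)) ^ 2 / 4) /
      (PO u q a * q ^ (((a : ℝ) ^ 2 + (b : ℝ)) / 2 - (a : ℝ)) * evenProd q (a - b))
  else if b ≤ a ∧ Odd (a - b) then
    u ^ a * PSp u q b * q ^ ((((a : ℝ) - (b : ℝ)) ^ 2 - 1) / 4) /
      (PO u q a * q ^ (((a : ℝ) ^ 2 - (a : ℝ)) / 2) * evenProd q (a - b - 1))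
  else 0

/-- The starting law of `λ'_1` for `R^e_{(u,q)}`, carried by the even numbers `a = 2k`. -/
def initEven (u q : ℝ) (a : ℕ) : ℝ :=
  let k := a / 2
  if Even a then
    eulerProd u q * (u ^ (2 * k) / (q ^ (2 * (k : ℤ) ^ 2 - (k : ℤ)) * denomEven u q k))
  else 0

/-- The starting law of `λ'_1` for `R^o_{(u,q)}`, carried by the odd numbers `a = 2k+1`. -/
def initOdd (u q : ℝ) (a : ℕ) : ℝ :=
  let k := a / 2
  if Odd a then eulerProd u q * (u ^ (2 * k) / (q ^ (2 * k ^ 2 + k) * denomOdd u q k))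
  else 0

/-- `p` is a probability mass function on the natural numbers. -/
def IsProbMass (p : ℕ → ℝ) : Prop := (∀ a, 0 ≤ p a) ∧ HasSum p 1

/-- `X 0, X 1, X 2, …` stand for `λ'_1, λ'_2, λ'_3, …`: the starting value has law `init`, and, given
the past, the step from `λ'_i = X (i-1)` to `λ'_{i+1} = X i` has the transition probabilities `K₁`
if `i` is odd (`i - 1` even) and `K₂` if `i` is even (`i - 1` odd). The condition is multiplied
out, so that pasts of probability zero need no convention. -/
structure IsAlternatingChain {Ω : Type*} [MeasurableSpace Ω] (P : MeasureTheory.Measure Ω)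
    (u q : ℝ) (init : ℕ → ℝ) (X : ℕ → Ω → ℕ) : Prop where
  measurable : ∀ n, Measurable (X n)
  start : ∀ a, P.real {ω | X 0 ω = a} = init a
  step : ∀ (n : ℕ) (a : ℕ → ℕ) (b : ℕ),
    P.real {ω | (∀ i ≤ n, X i ω = a i) ∧ X (n + 1) ω = b} =
      P.real {ω | ∀ i ≤ n, X i ω = a i} *
        (if Even n then K₁ u q (a n) b else K₂ u q (a n) b)

/-- Almost surely the sequence `X 0, X 1, …` is the sequence `λ'_1, λ'_2, …` of dual parts of a
partition `λ`, and this random partition has the mass function `R`. (A partition is determined by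
its dual parts.) -/
def PartitionHasLaw {Ω : Type*} [MeasurableSpace Ω] (P : MeasureTheory.Measure Ω)
    (X : ℕ → Ω → ℕ) (R : YoungDiagram → ℝ) : Prop :=
  (∀ᵐ ω ∂P, ∃ μ : YoungDiagram, ∀ j, X j ω = μ.colLen j) ∧
    ∀ μ : YoungDiagram, P.real {ω | ∀ j, X j ω = μ.colLen j} = R μ

end

end RandomPartition

namespace RandomPartition

noncomputable section

open Finset Filter Topology MeasureTheory

/-! Put x = 1/q^2 and v = u^2/q, so that 0 < x, v < 1, and write (v)_n for the Pochhammer symbol in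
base x.

Normalization rests on the finite Cauchy identity ∑_l T(k,l,v) = 1 (`sum_cauchyTerm`), where T is
`cauchyTerm`, and on its limit as k → ∞ (`hasSum_cauchyCoeff`). The rows of `K₁` are T(k,·,v) for a
= 2k and T(k,·,vx) for a = 2k+1. In the rows of `K₂` each such term is split in two, one piece for
an even b and one for an odd b. The two starting laws are the terms of the limiting identity at v
and at vx.

The law of the partition comes from telescoping. The weight factors over the columns of the diagram
(`weight_eq`), and each transition probability is a column factor times a quotient of values of
`potential` (`transition_eq`). Along the columns of a partition the potentials cancel up to the
initial one, because the potential at 0 is 1. The initial one combines with the starting law into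
the remaining constants, and the zeros of `K₁` impose the even multiplicities of the odd parts.

Almost surely the path is antitone, hence eventually constant. It cannot stay at a value c ≠ 0,
since `K₂ u q c c` is not 1 and this factor occurs infinitely often. So it reaches 0 and is the
column sequence of a diagram. The probability of that whole sequence is the limit of its prefix
probabilities, which become constant. -/

/-! ### The Cauchy identity, finite and infinite. -/

/-- The `x`-Pochhammer symbol `(v; x)_n = (1 - v)(1 - v x) ⋯ (1 - v x^(n-1))`. -/
def poch (v x : ℝ) (n : ℕ) : ℝ := ∏ i ∈ range n, (1 - v * x ^ i)

theorem poch_zero (v x : ℝ) : poch v x 0 = 1 := by simp [poch]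

theorem poch_succ (v x : ℝ) (n : ℕ) : poch v x (n + 1) = poch v x n * (1 - v * x ^ n) := by
  simp [poch, prod_range_succ]

theorem poch_succ' (v x : ℝ) (n : ℕ) : poch v x (n + 1) = (1 - v) * poch (v * x) x n := by
  simp only [poch, prod_range_succ', pow_zero, mul_one, pow_succ']
  rw [mul_comm]
  simp only [mul_assoc]

theorem one_sub_mul_pow_pos {v x : ℝ} (hv1 : v < 1) (hx0 : 0 ≤ x) (hx1 : x ≤ 1)
    (n : ℕ) : 0 < 1 - v * x ^ n := by
  have h1 : x ^ n ≤ 1 := pow_le_one₀ hx0 hx1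
  have h2 : 0 ≤ x ^ n := pow_nonneg hx0 n
  rcases le_total v 0 with hv | hv <;> nlinarith

theorem poch_pos {v x : ℝ} (hv1 : v < 1) (hx0 : 0 ≤ x) (hx1 : x ≤ 1) (n : ℕ) :
    0 < poch v x n :=
  prod_pos fun i _ => one_sub_mul_pow_pos hv1 hx0 hx1 i

theorem poch_le_one {v x : ℝ} (hv0 : 0 ≤ v) (hv1 : v < 1) (hx0 : 0 ≤ x) (hx1 : x ≤ 1) (n : ℕ) :
    poch v x n ≤ 1 :=
  prod_le_one (fun i _ => (one_sub_mul_pow_pos hv1 hx0 hx1 i).le)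
    fun i _ => by have := mul_nonneg hv0 (pow_nonneg hx0 i); linarith

/-- The terms of the finite Cauchy identity `∑_l cauchyTerm x k l v = 1`. -/
def cauchyTerm (x : ℝ) (k l : ℕ) (v : ℝ) : ℝ :=
  if l ≤ k then
    v ^ l * x ^ (l * (l - 1)) * poch v x k * poch x x k /
      (poch v x l * poch x x l * poch x x (k - l))
  else 0

theorem cauchyTerm_of_lt {x : ℝ} {k l : ℕ} (h : k < l) (v : ℝ) : cauchyTerm x k l v = 0 := by
  simp [cauchyTerm, h]

theorem cauchyTerm_nonneg {v x : ℝ} (hv0 : 0 ≤ v) (hv1 : v < 1) (hx0 : 0 ≤ x) (hx1 : x < 1)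
    (k l : ℕ) : 0 ≤ cauchyTerm x k l v := by
  unfold cauchyTerm
  split_ifs
  · have h1 := fun n => (poch_pos hv1 hx0 hx1.le n).le
    have h2 := fun n => (poch_pos hx1 hx0 hx1.le n).le
    have := h1 k; have := h1 l; have := h2 k; have := h2 l; have := h2 (k - l)
    positivity
  · rfl

theorem cauchyTerm_succ_zero {v x : ℝ} (hx0 : 0 ≤ x) (hx1 : x < 1) (k : ℕ) :
    cauchyTerm x (k + 1) 0 v = (1 - v * x ^ k) * cauchyTerm x k 0 v := by
  have h2 := fun n => (poch_pos hx1 hx0 hx1.le n).ne'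
  have := h2 k; have := h2 (k + 1)
  simp [cauchyTerm, poch_zero, poch_succ v]
  field_simp

/-- A q-Pascal rule. Since (vx)_k/(vx)_l = (v)_{k+1}/(v)_{l+1}, all three terms share a common
factor, and what is left is 1 - x^(k+1) = (1 - x^(k-l)) + x^(k-l) (1 - x^(l+1)). -/
theorem cauchyTerm_succ_succ {v x : ℝ} (hv0 : 0 ≤ v) (hv1 : v < 1) (hx0 : 0 < x) (hx1 : x < 1)
    (k l : ℕ) :
    cauchyTerm x (k + 1) (l + 1) v =
      (1 - v * x ^ k) * cauchyTerm x k (l + 1) v + v * x ^ k * cauchyTerm x k l (v * x) := by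
  have hvx : v * x < 1 := by nlinarith
  have hf := fun n => (one_sub_mul_pow_pos hv1 hx0.le hx1.le n).ne'
  have hg := fun n => (one_sub_mul_pow_pos hx1 hx0.le hx1.le n).ne'
  have h1 := fun n => (poch_pos hv1 hx0.le hx1.le n).ne'
  have h2 := fun n => (poch_pos hx1 hx0.le hx1.le n).ne'
  have h3 := fun n => (poch_pos hvx hx0.le hx1.le n).ne'
  have hv : 1 - v ≠ 0 := by linarith
  have hexp : (l + 1) * (l + 1 - 1) = l * (l - 1) + 2 * l := by
    cases l <;> simp; ring
  rcases lt_trichotomy l k with h | rfl | h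
  · obtain ⟨d, rfl⟩ := Nat.exists_eq_add_of_lt h
    have e1 : poch (v * x) x (l + d + 1) =
        poch v x (l + d + 1) * (1 - v * x ^ (l + d + 1)) / (1 - v) := by
      rw [← poch_succ, poch_succ' v x (l + d + 1)]; field_simp
    have e2 : poch (v * x) x l = poch v x (l + 1) / (1 - v) := by
      rw [poch_succ' v x l]; field_simp
    have d1 : l + d + 1 + 1 - (l + 1) = d + 1 := by omega
    have d2 : l + d + 1 - (l + 1) = d := by omega
    have d3 : l + d + 1 - l = d + 1 := by omega
    simp only [cauchyTerm, if_pos (show l + 1 ≤ l + d + 1 + 1 by omega),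
      if_pos (show l + 1 ≤ l + d + 1 by omega), if_pos (show l ≤ l + d + 1 by omega), d1, d2, d3,
      e1, e2, hexp, poch_succ x x l, poch_succ x x d, poch_succ x x (l + d + 1),
      poch_succ v x (l + d + 1)]
    have := h1 (l + 1); have := h2 l; have := h2 d; have := hg d; have := hg l
    field_simp
    ring
  · have e1 : poch (v * x) x l = poch v x (l + 1) / (1 - v) := by
      rw [poch_succ' v x l]; field_simp
    rw [cauchyTerm_of_lt (show l < l + 1 by omega)]
    have := h1 (l + 1); have := h2 l; have := h2 (l + 1)
    simp only [cauchyTerm, le_refl, if_true, Nat.sub_self, poch_zero, hexp, e1]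
    field_simp
    ring
  · rw [cauchyTerm_of_lt (by omega), cauchyTerm_of_lt (by omega), cauchyTerm_of_lt h]
    simp

/-- Summing the recurrence over l gives (1 - v x^k)·1 + v x^k·1 = 1. The induction has to run over
all v at once, because the second sum has parameter vx. -/
theorem sum_cauchyTerm {x : ℝ} (hx0 : 0 < x) (hx1 : x < 1) (k : ℕ) {v : ℝ} (hv0 : 0 ≤ v)
    (hv1 : v < 1) : ∑ l ∈ range (k + 1), cauchyTerm x k l v = 1 := by
  induction k generalizing v with
  | zero => simp [cauchyTerm, poch_zero]
  | succ k ih =>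
    have hvx : v * x < 1 := by nlinarith
    rw [sum_range_succ', cauchyTerm_succ_zero hx0.le hx1]
    simp only [cauchyTerm_succ_succ hv0 hv1 hx0 hx1, sum_add_distrib, ← mul_sum]
    rw [ih (mul_nonneg hv0 hx0.le) hvx, add_right_comm, ← mul_add,
      ← sum_range_succ' (fun l => cauchyTerm x k l v), sum_range_succ, ih hv0 hv1,
      cauchyTerm_of_lt (by omega)]
    ring

theorem hasSum_cauchyTerm {x : ℝ} (hx0 : 0 < x) (hx1 : x < 1) (k : ℕ) {v : ℝ} (hv0 : 0 ≤ v)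
    (hv1 : v < 1) : HasSum (fun l => cauchyTerm x k l v) 1 := by
  rw [← sum_cauchyTerm hx0 hx1 k hv0 hv1]
  refine hasSum_sum_of_ne_finset_zero fun l hl => cauchyTerm_of_lt ?_ v
  simpa using hl

theorem multipliable_poch {x : ℝ} (hx0 : 0 ≤ x) (hx1 : x < 1) (v : ℝ) :
    Multipliable fun i : ℕ => 1 - v * x ^ i := by
  simpa [sub_eq_add_neg] using Real.multipliable_one_add_of_summable
    ((summable_geometric_of_lt_one hx0 hx1).mul_left (-v))

theorem tendsto_poch {x : ℝ} (hx0 : 0 ≤ x) (hx1 : x < 1) (v : ℝ) :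
    Tendsto (poch v x) atTop (𝓝 (∏' i : ℕ, (1 - v * x ^ i))) :=
  (multipliable_poch hx0 hx1 v).hasProd.tendsto_prod_nat

/-- The terms of the infinite Cauchy identity. -/
def cauchyCoeff (x : ℝ) (l : ℕ) (v : ℝ) : ℝ :=
  v ^ l * x ^ (l * (l - 1)) / (poch v x l * poch x x l)

theorem cauchyCoeff_pos {v x : ℝ} (hv0 : 0 < v) (hv1 : v < 1) (hx0 : 0 < x) (hx1 : x < 1)
    (l : ℕ) : 0 < cauchyCoeff x l v := by
  have := poch_pos hv1 hx0.le hx1.le l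
  have := poch_pos hx1 hx0.le hx1.le l
  unfold cauchyCoeff
  positivity

theorem summable_cauchyCoeff {v x : ℝ} (hv0 : 0 < v) (hv1 : v < 1) (hx0 : 0 < x) (hx1 : x < 1) :
    Summable fun l => cauchyCoeff x l v := by
  have hpow : Tendsto (fun l : ℕ => x ^ l) atTop (𝓝 0) :=
    tendsto_pow_atTop_nhds_zero_of_lt_one hx0.le hx1
  refine summable_of_ratio_test_tendsto_lt_one zero_lt_one
    (Eventually.of_forall fun l => (cauchyCoeff_pos hv0 hv1 hx0 hx1 l).ne') ?_
  -- This is the ratio of consecutive terms; it tends to 0 because of the factor x^(2l).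
  have hlim : Tendsto (fun l : ℕ => v * (x ^ l) ^ 2 / ((1 - v * x ^ l) * (1 - x * x ^ l)))
      atTop (𝓝 (v * 0 ^ 2 / ((1 - v * 0) * (1 - x * 0)))) :=
    ((hpow.pow 2).const_mul v).div ((((hpow.const_mul v).const_sub 1)).mul
      ((hpow.const_mul x).const_sub 1)) (by simp)
  rw [show v * 0 ^ 2 / ((1 - v * 0) * (1 - x * 0)) = 0 by simp] at hlim
  refine hlim.congr fun l => ?_
  rw [Real.norm_of_nonneg (cauchyCoeff_pos hv0 hv1 hx0 hx1 _).le,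
    Real.norm_of_nonneg (cauchyCoeff_pos hv0 hv1 hx0 hx1 _).le]
  have hexp : (l + 1) * (l + 1 - 1) = l * (l - 1) + 2 * l := by
    cases l <;> simp; ring
  have := (poch_pos hv1 hx0.le hx1.le l).ne'
  have := (poch_pos hx1 hx0.le hx1.le l).ne'
  have := (one_sub_mul_pow_pos hv1 hx0.le hx1.le l).ne'
  have := (one_sub_mul_pow_pos hx1 hx0.le hx1.le l).ne'
  simp only [cauchyCoeff, hexp, poch_succ]
  field_simp
  ring

theorem tendsto_poch_div_poch {x : ℝ} (hx0 : 0 < x) (hx1 : x < 1) (l : ℕ) :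
    Tendsto (fun k => poch x x k / poch x x (k - l)) atTop (𝓝 1) := by
  rw [← tendsto_add_atTop_iff_nat l]
  have h : ∀ k, poch x x (k + l) / poch x x (k + l - l) =
      ∏ i ∈ range l, (1 - x * (x ^ k * x ^ i)) := fun k => by
    rw [Nat.add_sub_cancel, div_eq_iff (poch_pos hx1 hx0.le hx1.le k).ne', poch, prod_range_add,
      mul_comm]
    simp only [poch, pow_add]
  simp only [h]
  have hpow : Tendsto (fun l : ℕ => x ^ l) atTop (𝓝 0) :=
    tendsto_pow_atTop_nhds_zero_of_lt_one hx0.le hx1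
  have := tendsto_finsetProd (range l) fun i _ =>
    (((hpow.mul_const (x ^ i)).const_mul x).const_sub 1)
  simpa using this

/-- Let k → ∞ in the finite identity, by dominated convergence. One has T(k,l,v) = `cauchyCoeff x l
v` · (v)_k · (x)_k/(x)_{k-l}, where the last two factors are at most 1 and tend to the infinite
product and to 1. The coefficients themselves therefore dominate. -/
theorem hasSum_cauchyCoeff {v x : ℝ} (hv0 : 0 < v) (hv1 : v < 1) (hx0 : 0 < x) (hx1 : x < 1) :
    HasSum (fun l => (∏' i : ℕ, (1 - v * x ^ i)) * cauchyCoeff x l v) 1 := by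
  set C := ∏' i : ℕ, (1 - v * x ^ i)
  have hs := summable_cauchyCoeff hv0 hv1 hx0 hx1
  have h1 := fun n => poch_pos hv1 hx0.le hx1.le n
  have h2 := fun n => poch_pos hx1 hx0.le hx1.le n
  have key : Tendsto (fun k => ∑' l, cauchyTerm x k l v) atTop (𝓝 (∑' l, C * cauchyCoeff x l v)) := by
    refine tendsto_tsum_of_dominated_convergence hs (fun l => ?_)
      (Eventually.of_forall fun k l => ?_)
    · have := ((tendsto_poch hx0.le hx1 v).mul (tendsto_poch_div_poch hx0 hx1 l)).mul_const
        (cauchyCoeff x l v)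
      rw [mul_one] at this
      refine this.congr' ?_
      filter_upwards [eventually_ge_atTop l] with k hk
      rw [cauchyTerm, if_pos hk, cauchyCoeff]
      have := (h1 l).ne'; have := (h2 l).ne'; have := (h2 (k - l)).ne'
      field_simp
    · rw [Real.norm_of_nonneg (cauchyTerm_nonneg hv0.le hv1 hx0.le hx1 k l)]
      by_cases hk : l ≤ k
      · rw [cauchyTerm, if_pos hk, cauchyCoeff]
        have e : v ^ l * x ^ (l * (l - 1)) * poch v x k * poch x x k /
            (poch v x l * poch x x l * poch x x (k - l)) =
            v ^ l * x ^ (l * (l - 1)) / (poch v x l * poch x x l) *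
              (poch v x k * (poch x x k / poch x x (k - l))) := by
          have := (h1 l).ne'; have := (h2 l).ne'; have := (h2 (k - l)).ne'
          field_simp
        rw [e]
        refine mul_le_of_le_one_right (cauchyCoeff_pos hv0 hv1 hx0 hx1 l).le ?_
        refine mul_le_one₀ (poch_le_one hv0.le hv1 hx0.le hx1.le k)
          (div_nonneg (h2 _).le (h2 _).le) ?_
        rw [div_le_one (h2 _)]
        refine Finset.prod_le_prod_of_subset_of_le_one (range_mono (Nat.sub_le k l)) ?_ ?_
        · exact fun i _ => (one_sub_mul_pow_pos hx1 hx0.le hx1.le i).le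
        · exact fun i _ _ => by have := mul_pos hx0 (pow_pos hx0 i); linarith
      · rw [cauchyTerm_of_lt (by omega)]
        exact (cauchyCoeff_pos hv0 hv1 hx0 hx1 l).le
  simp only [(hasSum_cauchyTerm hx0 hx1 _ hv0.le hv1).tsum_eq] at key
  rw [tendsto_nhds_unique tendsto_const_nhds key]
  exact (hs.mul_left C).hasSum

/-! ### The products in q as Pochhammer symbols. -/

theorem one_div_sq_pos {q : ℝ} (hq : 1 < q) : 0 < 1 / q ^ 2 := by positivity

theorem one_div_sq_lt_one {q : ℝ} (hq : 1 < q) : 1 / q ^ 2 < 1 := by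
  rw [div_lt_one (by positivity)]
  nlinarith

theorem sq_div_lt_one {u q : ℝ} (hq : 1 < q) (huq : u ^ 2 < q) : u ^ 2 / q < 1 := by
  rwa [div_lt_one (by positivity)]

theorem one_sub_sq_div_pow {q : ℝ} (hq : 1 < q) (u : ℝ) (k : ℕ) :
    1 - u ^ 2 / q ^ (2 * k + 1) = 1 - u ^ 2 / q * (1 / q ^ 2) ^ k := by
  rw [one_div, inv_pow, pow_succ q, pow_mul]
  field_simp

theorem denomEven_eq {q : ℝ} (hq : 1 < q) (u : ℝ) (k : ℕ) :
    denomEven u q k = poch (u ^ 2 / q) (1 / q ^ 2) k * poch (1 / q ^ 2) (1 / q ^ 2) k := by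
  induction k with
  | zero => simp [denomEven, poch_zero]
  | succ k ih =>
    rw [denomEven, prod_Icc_succ_top (by omega), ← denomEven, ih, poch_succ, poch_succ,
      show 2 * (k + 1) - 1 = 2 * k + 1 by omega, one_sub_sq_div_pow hq,
      show 1 / q ^ (2 * (k + 1)) = 1 / q ^ 2 * (1 / q ^ 2) ^ k by
        rw [← pow_succ', ← one_div_pow, pow_mul, one_div_pow]]
    ring

theorem denomOdd_eq {q : ℝ} (hq : 1 < q) (u : ℝ) (k : ℕ) :
    denomOdd u q k = poch (u ^ 2 / q) (1 / q ^ 2) (k + 1) * poch (1 / q ^ 2) (1 / q ^ 2) k := by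
  rw [denomOdd, denomEven_eq hq, poch_succ, one_sub_sq_div_pow hq]
  ring

theorem eulerProd_eq {q : ℝ} (hq : 1 < q) (u : ℝ) :
    eulerProd u q = ∏' i : ℕ, (1 - u ^ 2 / q * (1 / q ^ 2) ^ i) := by
  simp only [eulerProd, one_sub_sq_div_pow hq]

/-- `(1 - 1/q^2)(1 - 1/q^4) ⋯ (1 - 1/q^(2m))`. -/
def recipProd (q : ℝ) (m : ℕ) : ℝ := ∏ j ∈ Icc 1 m, (1 - 1 / q ^ (2 * j))

theorem recipProd_eq (q : ℝ) (m : ℕ) : recipProd q m = poch (1 / q ^ 2) (1 / q ^ 2) m := by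
  induction m with
  | zero => simp [recipProd, poch_zero]
  | succ k ih =>
    rw [recipProd, prod_Icc_succ_top (by omega), ← recipProd, ih, poch_succ, ← pow_succ',
      pow_mul, one_div_pow]

theorem recipProd_pos {q : ℝ} (hq : 1 < q) (m : ℕ) : 0 < recipProd q m := by
  rw [recipProd_eq]
  exact poch_pos (one_div_sq_lt_one hq) (one_div_sq_pos hq).le (one_div_sq_lt_one hq).le m

theorem evenProd_eq {q : ℝ} (hq : 1 < q) (m : ℕ) :
    evenProd q m = q ^ (m / 2 * (m / 2 + 1)) * recipProd q (m / 2) := by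
  unfold evenProd
  induction m / 2 with
  | zero => simp [recipProd]
  | succ k ih =>
    rw [prod_Icc_succ_top (by omega), ih, recipProd, recipProd, prod_Icc_succ_top (by omega)]
    field_simp
    ring

theorem denomEven_pos {u q : ℝ} (hq : 1 < q) (huq : u ^ 2 < q) (k : ℕ) :
    0 < denomEven u q k := by
  have h1 := poch_pos (sq_div_lt_one hq huq) (one_div_sq_pos hq).le (one_div_sq_lt_one hq).le k
  have h2 := poch_pos (one_div_sq_lt_one hq) (one_div_sq_pos hq).le (one_div_sq_lt_one hq).le k
  rw [denomEven_eq hq]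
  positivity

theorem denomOdd_pos {u q : ℝ} (hq : 1 < q) (huq : u ^ 2 < q) (k : ℕ) :
    0 < denomOdd u q k := by
  have h1 := poch_pos (sq_div_lt_one hq huq) (one_div_sq_pos hq).le (one_div_sq_lt_one hq).le
    (k + 1)
  have h2 := poch_pos (one_div_sq_lt_one hq) (one_div_sq_pos hq).le (one_div_sq_lt_one hq).le k
  rw [denomOdd_eq hq]
  positivity

theorem PSp_two_mul (u q : ℝ) (k : ℕ) :
    PSp u q (2 * k) = u ^ (2 * k) / (q ^ (2 * k ^ 2 + k) * denomEven u q k) := by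
  simp [PSp]

theorem PSp_two_mul_add_one (u q : ℝ) (k : ℕ) :
    PSp u q (2 * k + 1) = u ^ (2 * k + 2) / (q ^ (2 * k ^ 2 + 3 * k + 1) * denomOdd u q k) := by
  simp [PSp, show (2 * k + 1) / 2 = k by omega]

theorem zpow_two_mul_sq_sub {q : ℝ} (hq : 1 < q) (k : ℕ) :
    q ^ (2 * (k : ℤ) ^ 2 - (k : ℤ)) = q ^ (2 * k ^ 2) / q ^ k := by
  rw [zpow_sub₀ (by positivity)]
  norm_cast

theorem PO_two_mul {q : ℝ} (hq : 1 < q) (u : ℝ) (k : ℕ) :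
    PO u q (2 * k) = u ^ (2 * k) * q ^ k / (q ^ (2 * k ^ 2) * denomEven u q k) := by
  simp only [PO, even_two, Even.mul_right, if_true, mul_div_cancel_left₀ k two_ne_zero]
  rw [zpow_two_mul_sq_sub hq, div_mul_eq_mul_div, div_div_eq_mul_div]

theorem PO_two_mul_add_one (u q : ℝ) (k : ℕ) :
    PO u q (2 * k + 1) = u ^ (2 * k + 1) / (q ^ (2 * k ^ 2 + k) * denomOdd u q k) := by
  simp [PO, show (2 * k + 1) / 2 = k by omega]

theorem PSp_pos {u q : ℝ} (hu : 0 < u) (hq : 1 < q) (huq : u ^ 2 < q) (a : ℕ) :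
    0 < PSp u q a := by
  have := denomEven_pos hq huq (a / 2)
  have := denomOdd_pos hq huq (a / 2)
  unfold PSp
  split_ifs <;> positivity

theorem PO_pos {u q : ℝ} (hu : 0 < u) (hq : 1 < q) (huq : u ^ 2 < q) (a : ℕ) :
    0 < PO u q a := by
  have := denomEven_pos hq huq (a / 2)
  have := denomOdd_pos hq huq (a / 2)
  unfold PO
  split_ifs <;> positivity

/-! ### Simplified kernels, and their evaluation as Cauchy terms. -/

/-- With a - b = 2d, `evenProd` contributes q^(d(d+1)), which cancels the dependence on b in the
explicit power of q. -/
theorem K₁_eq {q : ℝ} (hq : 1 < q) (u : ℝ) {a b : ℕ} (hab : b ≤ a) (he : Even (a - b)) :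
    K₁ u q a b = u ^ a * PO u q b /
      (PSp u q a * q ^ (((a : ℝ) ^ 2 + a) / 2) * recipProd q ((a - b) / 2)) := by
  obtain ⟨d, hd⟩ := he
  obtain rfl : a = b + (d + d) := by omega
  rw [K₁, if_pos ⟨hab, d, hd⟩, evenProd_eq hq, hd, show (d + d) / 2 = d by omega,
    ← Real.rpow_natCast q, mul_assoc, ← mul_assoc (q ^ _ : ℝ), ← Real.rpow_add (by positivity),
    ← mul_assoc]
  congr 4
  push_cast
  ring

theorem div_eq_div_of_mul_eq_mul {A n B e m F R : ℝ} (h : F * n = e * m) (hn : n ≠ 0) :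
    A * n / (B * e * (m * R)) = A / (B * F * R) := by
  rw [← mul_div_mul_right A _ hn]
  congr 1
  linear_combination (-B * R) * h

/-- Extracting q^(d(d+1)) from the even product, with d = ⌊(a-b)/2⌋, brings both parity cases to one
formula whose explicit power of q does not involve b. -/
theorem K₂_eq {q : ℝ} (hq : 1 < q) (u : ℝ) {a b : ℕ} (hab : b ≤ a) :
    K₂ u q a b = u ^ a * PSp u q b /
      (PO u q a * q ^ (((a : ℝ) ^ 2 - a) / 2) * recipProd q ((a - b) / 2)) := by
  have hq0 : 0 < q := by positivity
  rcases Nat.even_or_odd (a - b) with he | ho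
  · obtain ⟨d, hd⟩ := he
    obtain rfl : a = b + (d + d) := by omega
    rw [K₂, if_pos ⟨hab, d, hd⟩, evenProd_eq hq, hd, show (d + d) / 2 = d by omega]
    have h : q ^ ((((b + (d + d) : ℕ) : ℝ) ^ 2 + b) / 2 - ((b + (d + d) : ℕ) : ℝ)) *
        q ^ (d * (d + 1)) = q ^ ((((b + (d + d) : ℕ) : ℝ) ^ 2 - (b + (d + d) : ℕ)) / 2) *
        q ^ ((((b + (d + d) : ℕ) : ℝ) - b) ^ 2 / 4) := by
      rw [← Real.rpow_natCast q, ← Real.rpow_add hq0, ← Real.rpow_add hq0]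
      congr 1
      push_cast
      ring
    exact div_eq_div_of_mul_eq_mul h.symm (Real.rpow_pos_of_pos hq0 _).ne'
  · obtain ⟨d, hd⟩ := ho
    obtain rfl : a = b + (2 * d + 1) := by omega
    rw [K₂, if_neg (by rw [hd]; simp), if_pos ⟨hab, d, hd⟩, evenProd_eq hq, hd,
      show (2 * d + 1) / 2 = d by omega, show (2 * d + 1 - 1) / 2 = d by omega]
    have h : q ^ ((((b + (2 * d + 1) : ℕ) : ℝ) ^ 2 - ((b + (2 * d + 1) : ℕ) : ℝ)) / 2) *
        q ^ (d * (d + 1)) =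
        q ^ ((((b + (2 * d + 1) : ℕ) : ℝ) ^ 2 - (b + (2 * d + 1) : ℕ)) / 2) *
        q ^ (((((b + (2 * d + 1) : ℕ) : ℝ) - b) ^ 2 - 1) / 4) := by
      rw [← Real.rpow_natCast q, ← Real.rpow_add hq0, ← Real.rpow_add hq0]
      congr 1
      push_cast
      ring
    exact div_eq_div_of_mul_eq_mul h.symm (Real.rpow_pos_of_pos hq0 _).ne'

theorem pow_mul_pow_mul_pred {q : ℝ} (hq : 1 < q) (u : ℝ) (l : ℕ) :
    (u ^ 2 / q) ^ l * (1 / q ^ 2) ^ (l * (l - 1)) = u ^ (2 * l) * q ^ l / q ^ (2 * l ^ 2) := by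
  cases l with
  | zero => simp
  | succ l =>
    rw [div_pow, ← pow_mul, one_div_pow, ← pow_mul, Nat.add_sub_cancel]
    field_simp
    ring

theorem poch_mul_self {v x : ℝ} (hv : v < 1) (n : ℕ) :
    poch (v * x) x n = poch v x (n + 1) / (1 - v) := by
  rw [poch_succ', mul_div_cancel_left₀ _ (by linarith)]

theorem pow_mul_pow_mul_pred' {q : ℝ} (hq : 1 < q) (u : ℝ) (l : ℕ) :
    (u ^ 2 / q * (1 / q ^ 2)) ^ l * (1 / q ^ 2) ^ (l * (l - 1)) =
      u ^ (2 * l) / q ^ (2 * l ^ 2 + l) := by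
  rw [mul_pow, mul_right_comm, pow_mul_pow_mul_pred hq, one_div_pow, ← pow_mul]
  field_simp
  ring

theorem poch_base_pos {u q : ℝ} (hq : 1 < q) (huq : u ^ 2 < q) (n : ℕ) :
    0 < poch (u ^ 2 / q) (1 / q ^ 2) n :=
  poch_pos (sq_div_lt_one hq huq) (one_div_sq_pos hq).le (one_div_sq_lt_one hq).le n

theorem poch_self_pos {q : ℝ} (hq : 1 < q) (n : ℕ) : 0 < poch (1 / q ^ 2) (1 / q ^ 2) n :=
  poch_pos (one_div_sq_lt_one hq) (one_div_sq_pos hq).le (one_div_sq_lt_one hq).le n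

theorem half_sq_add_even (k : ℕ) :
    (((2 * k : ℕ) : ℝ) ^ 2 + (2 * k : ℕ)) / 2 = ((2 * k ^ 2 + k : ℕ) : ℝ) := by
  push_cast
  ring

theorem half_sq_add_odd (k : ℕ) :
    (((2 * k + 1 : ℕ) : ℝ) ^ 2 + (2 * k + 1 : ℕ)) / 2 = ((2 * k ^ 2 + 3 * k + 1 : ℕ) : ℝ) := by
  push_cast
  ring

theorem rpow_half_sq_sub_even {q : ℝ} (hq : 1 < q) (k : ℕ) :
    q ^ ((((2 * k : ℕ) : ℝ) ^ 2 - (2 * k : ℕ)) / 2) = q ^ (2 * k ^ 2) / q ^ k := by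
  rw [← Real.rpow_natCast q, ← Real.rpow_natCast q, ← Real.rpow_sub (by positivity)]
  congr 1
  push_cast
  ring

theorem half_sq_sub_odd (k : ℕ) :
    (((2 * k + 1 : ℕ) : ℝ) ^ 2 - (2 * k + 1 : ℕ)) / 2 = ((2 * k ^ 2 + k : ℕ) : ℝ) := by
  push_cast
  ring

section Evaluation

variable {u q : ℝ}

theorem K₁_two_mul (hu : 0 < u) (hq : 1 < q) (huq : u ^ 2 < q) (k l : ℕ) :
    K₁ u q (2 * k) (2 * l) = cauchyTerm (1 / q ^ 2) k l (u ^ 2 / q) := by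
  by_cases h : l ≤ k
  · have h1 := fun n => (poch_base_pos hq huq n).ne'
    have h2 := fun n => (poch_self_pos hq n).ne'
    rw [K₁_eq hq u (by omega) ⟨k - l, by omega⟩, PO_two_mul hq, PSp_two_mul, half_sq_add_even,
      Real.rpow_natCast, cauchyTerm, if_pos h, pow_mul_pow_mul_pred hq, recipProd_eq,
      denomEven_eq hq, denomEven_eq hq, show (2 * k - 2 * l) / 2 = k - l by omega]
    -- Only the nonvanishing of the Pochhammer values matters from here on; the rest is a comparison
    -- of monomials.
    generalize poch (u ^ 2 / q) (1 / q ^ 2) = f at *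
    generalize poch (1 / q ^ 2) (1 / q ^ 2) = g at *
    have := h1 k; have := h1 l; have := h2 k; have := h2 l; have := h2 (k - l)
    field_simp
  · rw [cauchyTerm_of_lt (by omega), K₁, if_neg (by omega)]

/-- The parameter moves to vx because `denomOdd` contains (v)_{k+1} = (1 - v)(vx)_k; the factors 1 -
v cancel between numerator and denominator. -/
theorem K₁_two_mul_add_one (hu : 0 < u) (hq : 1 < q) (huq : u ^ 2 < q) (k l : ℕ) :
    K₁ u q (2 * k + 1) (2 * l + 1) =
      cauchyTerm (1 / q ^ 2) k l (u ^ 2 / q * (1 / q ^ 2)) := by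
  by_cases h : l ≤ k
  · have h1 := fun n => (poch_base_pos hq huq n).ne'
    have h2 := fun n => (poch_self_pos hq n).ne'
    have hv : 1 - u ^ 2 / q ≠ 0 := by have := sq_div_lt_one hq huq; linarith
    rw [K₁_eq hq u (by omega) ⟨k - l, by omega⟩, PO_two_mul_add_one, PSp_two_mul_add_one,
      half_sq_add_odd, Real.rpow_natCast, cauchyTerm, if_pos h, pow_mul_pow_mul_pred' hq,
      recipProd_eq, denomOdd_eq hq, denomOdd_eq hq,
      show (2 * k + 1 - (2 * l + 1)) / 2 = k - l by omega, poch_mul_self (sq_div_lt_one hq huq),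
      poch_mul_self (sq_div_lt_one hq huq)]
    generalize poch (u ^ 2 / q) (1 / q ^ 2) = f at *
    generalize poch (1 / q ^ 2) (1 / q ^ 2) = g at *
    have := h1 (k + 1); have := h1 (l + 1); have := h2 k; have := h2 l; have := h2 (k - l)
    generalize 1 - u ^ 2 / q = w at *
    field_simp
    ring
  · rw [cauchyTerm_of_lt (by omega), K₁, if_neg (by omega)]

theorem K₂_even_even (hu : 0 < u) (hq : 1 < q) (huq : u ^ 2 < q) (k l : ℕ) :
    K₂ u q (2 * k) (2 * l) = (1 / q ^ 2) ^ l * cauchyTerm (1 / q ^ 2) k l (u ^ 2 / q) := by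
  by_cases h : l ≤ k
  · have h1 := fun n => (poch_base_pos hq huq n).ne'
    have h2 := fun n => (poch_self_pos hq n).ne'
    rw [K₂_eq hq u (by omega), PO_two_mul hq, PSp_two_mul, rpow_half_sq_sub_even hq,
      cauchyTerm, if_pos h, pow_mul_pow_mul_pred hq, recipProd_eq,
      denomEven_eq hq, denomEven_eq hq, show (2 * k - 2 * l) / 2 = k - l by omega]
    generalize poch (u ^ 2 / q) (1 / q ^ 2) = f at *
    generalize poch (1 / q ^ 2) (1 / q ^ 2) = g at *
    have := h1 k; have := h1 l; have := h2 k; have := h2 l; have := h2 (k - l)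
    rw [one_div_pow, ← pow_mul]
    field_simp
    ring
  · rw [cauchyTerm_of_lt (by omega), K₂, if_neg (by omega), if_neg (by omega), mul_zero]

/-- The target 2l+1 receives the share 1 - x^(l+1) of the Cauchy term of index l+1. The
complementary share x^(l+1) belongs to the target 2l+2. -/
theorem K₂_even_odd (hu : 0 < u) (hq : 1 < q) (huq : u ^ 2 < q) (k l : ℕ) :
    K₂ u q (2 * k) (2 * l + 1) = (1 - (1 / q ^ 2) ^ (l + 1)) *
      cauchyTerm (1 / q ^ 2) k (l + 1) (u ^ 2 / q) := by
  by_cases h : l + 1 ≤ k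
  · have h1 := fun n => (poch_base_pos hq huq n).ne'
    have h2 := fun n => (poch_self_pos hq n).ne'
    have h3 := (one_sub_mul_pow_pos (one_div_sq_lt_one hq) (one_div_sq_pos hq).le
      (one_div_sq_lt_one hq).le l).ne'
    rw [K₂_eq hq u (by omega), PO_two_mul hq, PSp_two_mul_add_one, rpow_half_sq_sub_even hq,
      cauchyTerm, if_pos h, pow_mul_pow_mul_pred hq, recipProd_eq,
      denomEven_eq hq, denomOdd_eq hq, show (2 * k - (2 * l + 1)) / 2 = k - (l + 1) by omega,
      poch_succ (1 / q ^ 2) _ l, pow_succ' (1 / q ^ 2) l]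
    generalize poch (u ^ 2 / q) (1 / q ^ 2) = f at *
    generalize poch (1 / q ^ 2) (1 / q ^ 2) = g at *
    have := h1 k; have := h1 (l + 1); have := h2 k; have := h2 l; have := h2 (k - (l + 1))
    generalize 1 - 1 / q ^ 2 * (1 / q ^ 2) ^ l = w at *
    field_simp
    ring
  · rw [cauchyTerm_of_lt (by omega), K₂, if_neg (by omega), if_neg (by omega), mul_zero]

theorem K₂_odd_odd (hu : 0 < u) (hq : 1 < q) (huq : u ^ 2 < q) (k l : ℕ) :
    K₂ u q (2 * k + 1) (2 * l + 1) = u ^ 2 / q * (1 / q ^ 2) ^ l *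
      cauchyTerm (1 / q ^ 2) k l (u ^ 2 / q * (1 / q ^ 2)) := by
  by_cases h : l ≤ k
  · have h1 := fun n => (poch_base_pos hq huq n).ne'
    have h2 := fun n => (poch_self_pos hq n).ne'
    have hv : 1 - u ^ 2 / q ≠ 0 := by have := sq_div_lt_one hq huq; linarith
    rw [K₂_eq hq u (by omega), PO_two_mul_add_one, PSp_two_mul_add_one,
      half_sq_sub_odd, Real.rpow_natCast, cauchyTerm, if_pos h, pow_mul_pow_mul_pred' hq,
      recipProd_eq, denomOdd_eq hq, denomOdd_eq hq,
      show (2 * k + 1 - (2 * l + 1)) / 2 = k - l by omega, poch_mul_self (sq_div_lt_one hq huq),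
      poch_mul_self (sq_div_lt_one hq huq)]
    generalize poch (u ^ 2 / q) (1 / q ^ 2) = f at *
    generalize poch (1 / q ^ 2) (1 / q ^ 2) = g at *
    have := h1 (k + 1); have := h1 (l + 1); have := h2 k; have := h2 l; have := h2 (k - l)
    generalize 1 - u ^ 2 / q = w at *
    rw [one_div_pow, ← pow_mul]
    field_simp
    ring
  · rw [cauchyTerm_of_lt (by omega), K₂, if_neg (by omega), if_neg (by omega), mul_zero]

/-- The share 1 - v x^l of a Cauchy term goes to 2l, and the complementary share v x^l to 2l+1. -/
theorem K₂_odd_even (hu : 0 < u) (hq : 1 < q) (huq : u ^ 2 < q) (k l : ℕ) :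
    K₂ u q (2 * k + 1) (2 * l) = (1 - u ^ 2 / q * (1 / q ^ 2) ^ l) *
      cauchyTerm (1 / q ^ 2) k l (u ^ 2 / q * (1 / q ^ 2)) := by
  by_cases h : l ≤ k
  · have h1 := fun n => (poch_base_pos hq huq n).ne'
    have h2 := fun n => (poch_self_pos hq n).ne'
    have hv : 1 - u ^ 2 / q ≠ 0 := by have := sq_div_lt_one hq huq; linarith
    have h3 := (one_sub_mul_pow_pos (sq_div_lt_one hq huq) (one_div_sq_pos hq).le
      (one_div_sq_lt_one hq).le l).ne'
    rw [K₂_eq hq u (by omega), PO_two_mul_add_one, PSp_two_mul,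
      half_sq_sub_odd, Real.rpow_natCast, cauchyTerm, if_pos h, pow_mul_pow_mul_pred' hq,
      recipProd_eq, denomOdd_eq hq, denomEven_eq hq,
      show (2 * k + 1 - 2 * l) / 2 = k - l by omega, poch_mul_self (sq_div_lt_one hq huq),
      poch_mul_self (sq_div_lt_one hq huq), poch_succ _ _ l]
    generalize poch (u ^ 2 / q) (1 / q ^ 2) = f at *
    generalize poch (1 / q ^ 2) (1 / q ^ 2) = g at *
    have := h1 (k + 1); have := h1 l; have := h2 k; have := h2 l; have := h2 (k - l)
    generalize 1 - u ^ 2 / q * (1 / q ^ 2) ^ l = w' at *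
    generalize 1 - u ^ 2 / q = w at *
    field_simp
  · rw [cauchyTerm_of_lt (by omega), K₂, if_neg (by omega), if_neg (by omega), mul_zero]

/-! ### Kernels and starting laws are probability distributions. -/

theorem K₁_nonneg (hu : 0 < u) (hq : 1 < q) (huq : u ^ 2 < q) (a b : ℕ) : 0 ≤ K₁ u q a b := by
  by_cases h : b ≤ a ∧ Even (a - b)
  · rw [K₁_eq hq u h.1 h.2]
    have := PO_pos hu hq huq b
    have := PSp_pos hu hq huq a
    have := recipProd_pos hq ((a - b) / 2)
    positivity
  · rw [K₁, if_neg h]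

theorem K₂_pos (hu : 0 < u) (hq : 1 < q) (huq : u ^ 2 < q) {a b : ℕ} (h : b ≤ a) :
    0 < K₂ u q a b := by
  rw [K₂_eq hq u h]
  have := PSp_pos hu hq huq b
  have := PO_pos hu hq huq a
  have := recipProd_pos hq ((a - b) / 2)
  positivity

theorem K₁_eq_zero_of_lt {a b : ℕ} (h : a < b) : K₁ u q a b = 0 := by
  rw [K₁, if_neg (by omega)]

theorem K₂_eq_zero_of_lt {a b : ℕ} (h : a < b) : K₂ u q a b = 0 := by
  rw [K₂, if_neg (by omega), if_neg (by omega)]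

theorem K₂_nonneg (hu : 0 < u) (hq : 1 < q) (huq : u ^ 2 < q) (a b : ℕ) : 0 ≤ K₂ u q a b := by
  rcases le_or_gt b a with h | h
  · exact (K₂_pos hu hq huq h).le
  · exact (K₂_eq_zero_of_lt h).ge

theorem hasSum_of_forall_eq {f g : ℕ → ℝ} {s : ℝ} (h : ∀ n, f n = g n) (hg : HasSum g s) :
    HasSum f s := by
  rwa [funext h]

theorem isProbMass_K₁ (hu : 0 < u) (hq : 1 < q) (huq : u ^ 2 < q) (a : ℕ) :
    IsProbMass (K₁ u q a) := by
  refine ⟨K₁_nonneg hu hq huq a, ?_⟩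
  have hx0 := one_div_sq_pos hq
  have hx1 := one_div_sq_lt_one hq
  have hv0 : 0 < u ^ 2 / q := by positivity
  have hv1 := sq_div_lt_one hq huq
  obtain ⟨k, rfl | rfl⟩ := Nat.even_or_odd' a
  · have h1 : HasSum (fun l => K₁ u q (2 * k) (2 * l)) 1 := by
      simpa only [K₁_two_mul hu hq huq] using hasSum_cauchyTerm hx0 hx1 k hv0.le hv1
    have h2 : HasSum (fun l => K₁ u q (2 * k) (2 * l + 1)) 0 := by
      have : ∀ l, K₁ u q (2 * k) (2 * l + 1) = 0 := fun l => by
        rw [K₁, if_neg]; rintro ⟨_, h⟩; rw [Nat.even_iff] at h; omega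
      simpa only [this] using hasSum_zero
    simpa using h1.even_add_odd h2
  · have h1 : HasSum (fun l => K₁ u q (2 * k + 1) (2 * l)) 0 := by
      have : ∀ l, K₁ u q (2 * k + 1) (2 * l) = 0 := fun l => by
        rw [K₁, if_neg]; rintro ⟨_, h⟩; rw [Nat.even_iff] at h; omega
      simpa only [this] using hasSum_zero
    have h2 : HasSum (fun l => K₁ u q (2 * k + 1) (2 * l + 1)) 1 := by
      simpa only [K₁_two_mul_add_one hu hq huq] using
        hasSum_cauchyTerm hx0 hx1 k (mul_pos hv0 hx0).le (by nlinarith)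
    simpa using h1.even_add_odd h2

/-- Adding the two shares of each Cauchy term recovers the term, so the even and odd targets
together sum to 1 by the Cauchy identity. -/
theorem isProbMass_K₂ (hu : 0 < u) (hq : 1 < q) (huq : u ^ 2 < q) (a : ℕ) :
    IsProbMass (K₂ u q a) := by
  refine ⟨K₂_nonneg hu hq huq a, ?_⟩
  have hx0 := one_div_sq_pos hq
  have hx1 := one_div_sq_lt_one hq
  have hv0 : 0 < u ^ 2 / q := by positivity
  have hv1 := sq_div_lt_one hq huq
  obtain ⟨k, rfl | rfl⟩ := Nat.even_or_odd' a
  · set T := fun l => cauchyTerm (1 / q ^ 2) k l (u ^ 2 / q) with hT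
    have hz : ∀ c : ℕ → ℝ, ∀ l ∉ range (k + 1), c l * T l = 0 := fun c l hl => by
      rw [hT]; simp only; rw [cauchyTerm_of_lt (by simpa using hl), mul_zero]
    have h1 := hasSum_sum_of_ne_finset_zero (L := .unconditional ℕ)
      (hz fun l => (1 / q ^ 2) ^ l)
    have h2 := hasSum_sum_of_ne_finset_zero (L := .unconditional ℕ)
      (hz fun l => 1 - (1 / q ^ 2) ^ l)
    have h3 := (h1.add h2)
    rw [← sum_add_distrib, sum_congr rfl fun l _ =>
      show (1 / q ^ 2) ^ l * T l + (1 - (1 / q ^ 2) ^ l) * T l = T l by ring,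
      sum_cauchyTerm hx0 hx1 k hv0.le hv1] at h3
    -- The share 1 - x^0 of the term l = 0 is zero, so the series may start at l = 1, which is the
    -- indexing of the odd targets.
    have h2' := (hasSum_nat_add_iff' 1).2 h2
    simp only [range_one, sum_singleton, pow_zero, sub_self, zero_mul, sub_zero] at h2'
    have h4 := hasSum_of_forall_eq (K₂_even_even hu hq huq k) h1
    have h5 := hasSum_of_forall_eq (K₂_even_odd hu hq huq k) h2'
    have h6 := h4.even_add_odd h5
    rwa [(h1.add h2).unique h3] at h6
  · have hs := hasSum_cauchyTerm hx0 hx1 k (mul_pos hv0 hx0).le (by nlinarith)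
    set T := fun l => cauchyTerm (1 / q ^ 2) k l (u ^ 2 / q * (1 / q ^ 2)) with hT
    have hz : ∀ c : ℕ → ℝ, ∀ l ∉ range (k + 1), c l * T l = 0 := fun c l hl => by
      rw [hT]; simp only; rw [cauchyTerm_of_lt (by simpa using hl), mul_zero]
    have h1 := hasSum_sum_of_ne_finset_zero (L := .unconditional ℕ)
      (hz fun l => 1 - u ^ 2 / q * (1 / q ^ 2) ^ l)
    have h2 := hasSum_sum_of_ne_finset_zero (L := .unconditional ℕ)
      (hz fun l => u ^ 2 / q * (1 / q ^ 2) ^ l)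
    have h3 := h1.add h2
    simp only [← add_mul, sub_add_cancel, one_mul] at h3
    have h4 := hasSum_of_forall_eq (K₂_odd_even hu hq huq k) h1
    have h5 := hasSum_of_forall_eq (K₂_odd_odd hu hq huq k) h2
    have h6 := h4.even_add_odd h5
    rwa [h3.unique hs] at h6

theorem eulerProd_nonneg (hq : 1 < q) (huq : u ^ 2 < q) : 0 ≤ eulerProd u q := by
  rw [eulerProd_eq hq]
  exact ge_of_tendsto' (tendsto_poch (one_div_sq_pos hq).le (one_div_sq_lt_one hq) _)
    fun n => (poch_base_pos hq huq n).le

theorem initEven_of_even {a : ℕ} (ha : Even a) : initEven u q a = eulerProd u q * PO u q a := by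
  simp [initEven, PO, ha]

theorem initOdd_of_odd (hu : 0 < u) {a : ℕ} (ha : Odd a) :
    initOdd u q a = eulerProd u q * PO u q a / u := by
  simp only [initOdd, PO, ha, Nat.not_even_iff_odd.2 ha, if_true, if_false, pow_succ u]
  field_simp

theorem isProbMass_initEven (hu : 0 < u) (hq : 1 < q) (huq : u ^ 2 < q) :
    IsProbMass (initEven u q) := by
  have hC := eulerProd_nonneg hq huq
  constructor
  · intro a
    have := denomEven_pos hq huq (a / 2)
    unfold initEven
    split_ifs <;> positivity
  · have h1 : HasSum (fun k => initEven u q (2 * k)) 1 := by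
      have hv0 : 0 < u ^ 2 / q := by positivity
      convert hasSum_cauchyCoeff hv0 (sq_div_lt_one hq huq) (one_div_sq_pos hq)
        (one_div_sq_lt_one hq) using 2 with k
      rw [initEven_of_even (even_two_mul k), PO_two_mul hq, cauchyCoeff,
        pow_mul_pow_mul_pred hq, ← denomEven_eq hq, ← eulerProd_eq hq, div_div]
    have h2 : HasSum (fun k => initEven u q (2 * k + 1)) 0 := by
      simp [initEven, hasSum_zero]
    simpa using h1.even_add_odd h2

/-- Splits off the first factor: the Cauchy identity at vx supplies only the product from the second
factor on, and 1 - v makes up for the extra factor in `denomOdd`. -/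
theorem eulerProd_eq_mul (hq : 1 < q) :
    eulerProd u q =
      (1 - u ^ 2 / q) * ∏' i : ℕ, (1 - u ^ 2 / q * (1 / q ^ 2) * (1 / q ^ 2) ^ i) := by
  rw [eulerProd_eq hq]
  refine tendsto_nhds_unique ((tendsto_add_atTop_iff_nat 1).2 (tendsto_poch
    (one_div_sq_pos hq).le (one_div_sq_lt_one hq) _)) ?_
  simp only [poch_succ']
  exact (tendsto_poch (one_div_sq_pos hq).le (one_div_sq_lt_one hq) _).const_mul _

theorem isProbMass_initOdd (hu : 0 < u) (hq : 1 < q) (huq : u ^ 2 < q) :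
    IsProbMass (initOdd u q) := by
  have hC := eulerProd_nonneg hq huq
  constructor
  · intro a
    have := denomOdd_pos hq huq (a / 2)
    unfold initOdd
    split_ifs <;> positivity
  · have h1 : HasSum (fun k => initOdd u q (2 * k + 1)) 1 := by
      have hx0 := one_div_sq_pos hq
      have hv1 := sq_div_lt_one hq huq
      have hx1 := one_div_sq_lt_one hq
      have hv0 : 0 < u ^ 2 / q := by positivity
      convert hasSum_cauchyCoeff (mul_pos hv0 hx0) (by nlinarith) hx0 hx1 using 2 with k
      have h1 := (poch_base_pos hq huq (k + 1)).ne'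
      have h2 := (poch_self_pos hq k).ne'
      have hv : 1 - u ^ 2 / q ≠ 0 := by linarith
      rw [initOdd_of_odd hu (odd_two_mul_add_one k), PO_two_mul_add_one, cauchyCoeff,
        pow_mul_pow_mul_pred' hq, denomOdd_eq hq, eulerProd_eq_mul hq, poch_mul_self hv1,
        pow_succ u (2 * k)]
      generalize poch (u ^ 2 / q) (1 / q ^ 2) (k + 1) = f at *
      generalize poch (1 / q ^ 2) (1 / q ^ 2) k = g at *
      generalize (∏' i : ℕ, (1 - u ^ 2 / q * (1 / q ^ 2) * (1 / q ^ 2) ^ i)) = t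
      generalize 1 - u ^ 2 / q = w at *
      field_simp
    have h2 : HasSum (fun k => initOdd u q (2 * k)) 0 := by
      simp [initOdd, Nat.not_odd_iff_even.2 (even_two_mul _), hasSum_zero]
    simpa using h2.even_add_odd h1

end Evaluation

/-! ### The weight as a product over columns. -/

theorem colLen_pos_iff (μ : YoungDiagram) (j : ℕ) : 0 < μ.colLen j ↔ j < μ.rowLen 0 := by
  rw [← YoungDiagram.mem_iff_lt_colLen, YoungDiagram.mem_iff_lt_rowLen]

theorem numParts_eq (μ : YoungDiagram) : numParts μ = μ.colLen 0 := YoungDiagram.length_rowLens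

theorem countP_rowLens (μ : YoungDiagram) (p : ℕ → Prop) [DecidablePred p] :
    μ.rowLens.countP (fun i => decide (p i)) = #{r ∈ range (μ.colLen 0) | p (μ.rowLen r)} := by
  rw [YoungDiagram.rowLens, List.countP_map]
  simp [Finset.card_def, Finset.filter, Multiset.range,
    List.countP_eq_length_filter, Function.comp_def]

/-- The rows of length exactly j+1 are those with index r in the interval `μ.colLen (j + 1)` ≤ r <
`μ.colLen j`. -/
theorem mult_succ (μ : YoungDiagram) (j : ℕ) :
    mult μ (j + 1) = μ.colLen j - μ.colLen (j + 1) := by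
  rw [mult, List.count_eq_countP]
  have := countP_rowLens μ (fun i => i = j + 1)
  simp only [beq_eq_decide]
  rw [this, ← Nat.card_Ico]
  congr 1
  ext r
  have h0 := @YoungDiagram.mem_iff_lt_rowLen μ r j
  have h1 := @YoungDiagram.mem_iff_lt_rowLen μ r (j + 1)
  rw [YoungDiagram.mem_iff_lt_colLen] at h0 h1
  have := μ.colLen_anti 0 j (by omega)
  simp only [mem_filter, mem_range, mem_Ico]
  omega

theorem card_eq_sum_colLen (μ : YoungDiagram) :
    μ.card = ∑ j ∈ range (μ.rowLen 0), μ.colLen j := by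
  rw [YoungDiagram.card, card_eq_sum_card_fiberwise (f := Prod.snd) (t := range (μ.rowLen 0))]
  · refine sum_congr rfl fun j _ => ?_
    rw [YoungDiagram.colLen_eq_card]
    rfl
  · rintro ⟨i, j⟩ h
    have h : (i, j) ∈ μ := h
    rw [YoungDiagram.mem_iff_lt_rowLen] at h
    have := μ.rowLen_anti 0 i (by omega)
    simp only [coe_range, Set.mem_Iio]
    omega

theorem numOddParts_eq (μ : YoungDiagram) :
    numOddParts μ = ∑ j ∈ range (μ.rowLen 0), if Even j then mult μ (j + 1) else 0 := by
  -- Rows are grouped by length minus one, so odd lengths correspond to even column indices j. An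
  -- odd length is positive, so the truncated subtraction is harmless.
  rw [numOddParts, countP_rowLens, card_eq_sum_card_fiberwise (f := fun r => μ.rowLen r - 1)
    (t := range (μ.rowLen 0))]
  · refine sum_congr rfl fun j _ => ?_
    split_ifs with hj
    · rw [mult, List.count_eq_countP]
      simp only [beq_eq_decide]
      rw [countP_rowLens μ (fun i => i = j + 1), filter_filter]
      congr 1
      refine filter_congr fun r hr => ?_
      have := hj.add_one
      constructor
      · rintro ⟨h1, h2⟩; have := h1.pos; omega
      · intro h; rw [h]; exact ⟨this, rfl⟩
    · rw [card_eq_zero, filter_filter, filter_eq_empty_iff]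
      rintro r - ⟨h1, h2⟩
      apply hj
      rw [← h2]
      exact Nat.Odd.sub_odd h1 odd_one
  · intro r hr
    simp only [coe_filter, mem_range, Set.mem_ofPred_eq] at hr
    have := μ.rowLen_anti 0 r (by omega)
    have := hr.2.pos
    simp only [coe_range, Set.mem_Iio]
    omega

/-- The contribution of the columns `j` and `j + 1`, of lengths `a` and `b`, to the weight of a
partition. -/
def columnWeight (u q : ℝ) (j a b : ℕ) : ℝ :=
  u ^ a / (q ^ ((a : ℝ) ^ 2 / 2 + (if Even j then ((a : ℝ) - b) / 2 else 0)) *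
    recipProd q ((a - b) / 2))

theorem columnWeight_zero (u q : ℝ) (j : ℕ) : columnWeight u q j 0 0 = 1 := by
  simp [columnWeight, recipProd]

/-- For column lengths a_j, binom(a_j, 2) + a_j/2 = a_j^2/2, and the odd parts j+1 (j even)
contribute (a_j - a_{j+1})/2. So the exponent of q is a sum over columns. -/
theorem weight_eq {q : ℝ} (hq : 1 < q) (u : ℝ) (μ : YoungDiagram) :
    weight u q μ = q ^ μ.colLen 0 *
      ∏ j ∈ range (μ.rowLen 0), columnWeight u q j (μ.colLen j) (μ.colLen (j + 1)) := by
  have hq0 : 0 < q := by positivity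
  have hexp : (nStat μ : ℝ) + (μ.card : ℝ) / 2 + (numOddParts μ : ℝ) / 2 =
      ∑ j ∈ range (μ.rowLen 0), ((μ.colLen j : ℝ) ^ 2 / 2 +
        (if Even j then ((μ.colLen j : ℝ) - μ.colLen (j + 1)) / 2 else 0)) := by
    rw [nStat, card_eq_sum_colLen, numOddParts_eq]
    push_cast
    rw [sum_div, sum_div, ← sum_add_distrib, ← sum_add_distrib]
    refine sum_congr rfl fun j _ => ?_
    rw [mult_succ, Nat.cast_choose_two]
    split_ifs
    · rw [Nat.cast_sub (μ.colLen_anti j (j + 1) (by omega))]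
      ring
    · ring
  have hprod : ∏ i ∈ Icc 1 (μ.rowLen 0), ∏ j ∈ Icc 1 (mult μ i / 2), (1 - 1 / q ^ (2 * j)) =
      ∏ j ∈ range (μ.rowLen 0), recipProd q ((μ.colLen j - μ.colLen (j + 1)) / 2) := by
    simp only [← mult_succ]
    change ∏ i ∈ Icc 1 (μ.rowLen 0), recipProd q (mult μ i / 2) = _
    induction μ.rowLen 0 with
    | zero => simp
    | succ n ih => rw [prod_Icc_succ_top (by omega), prod_range_succ, ih]
  rw [weight, hexp, hprod, numParts_eq, card_eq_sum_colLen, ← prod_pow_eq_pow_sum,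
    Real.rpow_sum_of_pos hq0, mul_div_assoc, ← prod_mul_distrib, ← prod_div_distrib]
  rfl

/-! ### Telescoping of path probabilities. -/

/-- The factor that telescopes along the chain. -/
def potential (u q : ℝ) (j a : ℕ) : ℝ :=
  if Even j then PSp u q a else PO u q a / q ^ ((a : ℝ) / 2)

/-- The transition probabilities of the alternating chain. -/
def transition (u q : ℝ) (j a b : ℕ) : ℝ := if Even j then K₁ u q a b else K₂ u q a b

section Telescoping

variable {u q : ℝ}

theorem potential_pos (hu : 0 < u) (hq : 1 < q) (huq : u ^ 2 < q) (j a : ℕ) :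
    0 < potential u q j a := by
  have := PSp_pos hu hq huq a
  have := PO_pos hu hq huq a
  unfold potential
  split_ifs <;> positivity

theorem potential_zero (u q : ℝ) (j : ℕ) : potential u q j 0 = 1 := by
  simp [potential, PSp, PO, denomEven]

/-- The factor q^(a/2) in the odd-index potential accounts for the gap between the kernel exponents
(a^2 ± a)/2 and the column exponents. The parity condition is needed because `K₁` vanishes for odd a
- b, while `columnWeight` does not. -/
theorem transition_eq (hu : 0 < u) (hq : 1 < q) (huq : u ^ 2 < q) {j a b : ℕ} (hab : b ≤ a)
    (he : Even j → Even (a - b)) :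
    transition u q j a b =
      potential u q (j + 1) b / potential u q j a * columnWeight u q j a b := by
  have hq0 : 0 < q := by positivity
  have hp : ∀ s : ℝ, q ^ s ≠ 0 := fun s => (Real.rpow_pos_of_pos hq0 s).ne'
  have := (PSp_pos hu hq huq a).ne'
  have := (PO_pos hu hq huq a).ne'
  have := (recipProd_pos hq ((a - b) / 2)).ne'
  by_cases hj : Even j
  · have hj' : ¬ Even (j + 1) := by simpa [Nat.even_add_one] using hj
    rw [transition, if_pos hj, potential, if_neg hj', potential, if_pos hj, columnWeight, if_pos hj,
      K₁_eq hq u hab (he hj), show ((a : ℝ) ^ 2 + a) / 2 = (b : ℝ) / 2 +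
        ((a : ℝ) ^ 2 / 2 + ((a : ℝ) - b) / 2) by ring, Real.rpow_add hq0 ((b : ℝ) / 2)]
    have := hp (b / 2)
    have := hp ((a : ℝ) ^ 2 / 2 + ((a : ℝ) - b) / 2)
    field_simp
  · have hj' : Even (j + 1) := by simpa [Nat.even_add_one] using hj
    have h : q ^ ((a : ℝ) ^ 2 / 2) = q ^ (((a : ℝ) ^ 2 - a) / 2) * q ^ ((a : ℝ) / 2) := by
      rw [← Real.rpow_add hq0]
      ring_nf
    rw [transition, if_neg hj, potential, if_pos hj', potential, if_neg hj, columnWeight,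
      if_neg hj, K₂_eq hq u hab, add_zero, h]
    have := hp (a / 2)
    have := hp (((a : ℝ) ^ 2 - a) / 2)
    field_simp

theorem prod_transition (hu : 0 < u) (hq : 1 < q) (huq : u ^ 2 < q) {a : ℕ → ℕ}
    (ha : ∀ j, a (j + 1) ≤ a j) (he : ∀ j, Even j → Even (a j - a (j + 1))) (n : ℕ) :
    ∏ j ∈ range n, transition u q j (a j) (a (j + 1)) =
      potential u q n (a n) / PSp u q (a 0) *
        ∏ j ∈ range n, columnWeight u q j (a j) (a (j + 1)) := by
  have hp := fun j a => (potential_pos hu hq huq j a).ne'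
  induction n with
  | zero => simpa [potential] using (div_self (PSp_pos hu hq huq (a 0)).ne').symm
  | succ n ih =>
    have := hp n (a n)
    rw [prod_range_succ, prod_range_succ, ih, transition_eq hu hq huq (ha n) (he n)]
    field_simp

theorem PO_even_eq (hu : 0 < u) (hq : 1 < q) {a : ℕ} (ha : Even a) :
    PO u q a = q ^ a * PSp u q a := by
  obtain ⟨k, rfl⟩ := ha
  rw [← two_mul, PO_two_mul hq, PSp_two_mul, mul_div_assoc']
  field_simp
  ring

/-- The 1/u here and the 1/u in `initOdd_of_odd` together produce the factor 1/u^2 of `Ro`. -/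
theorem PO_odd_eq (hu : 0 < u) (hq : 1 < q) {a : ℕ} (ha : Odd a) :
    PO u q a = q ^ a * PSp u q a / u := by
  obtain ⟨k, rfl⟩ := ha
  rw [PO_two_mul_add_one, PSp_two_mul_add_one]
  field_simp
  ring

/-- The probability that the chain starts with `a 0, …, a n`. -/
def pathProb (u q : ℝ) (init : ℕ → ℝ) (a : ℕ → ℕ) (n : ℕ) : ℝ :=
  init (a 0) * ∏ j ∈ range n, transition u q j (a j) (a (j + 1))

theorem oddPartsEvenMult_iff (μ : YoungDiagram) :
    OddPartsEvenMult μ ↔ ∀ j, Even j → Even (μ.colLen j - μ.colLen (j + 1)) := by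
  constructor
  · intro h j hj
    rw [← mult_succ]
    exact h _ hj.add_one
  · rintro h i ⟨k, rfl⟩
    rw [mult_succ]
    exact h _ (even_two_mul k)

theorem colLen_eq_zero {μ : YoungDiagram} {j : ℕ} (h : μ.rowLen 0 ≤ j) : μ.colLen j = 0 := by
  have := colLen_pos_iff μ j
  omega

/-- After the last nonempty column the potential equals 1 and every column factor equals 1. Only the
initial potential survives, and the product no longer depends on n. -/
theorem prod_transition_colLen (hu : 0 < u) (hq : 1 < q) (huq : u ^ 2 < q) (μ : YoungDiagram)
    (h : OddPartsEvenMult μ) {n : ℕ} (hn : μ.rowLen 0 ≤ n) :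
    q ^ μ.colLen 0 * PSp u q (μ.colLen 0) *
      ∏ j ∈ range n, transition u q j (μ.colLen j) (μ.colLen (j + 1)) = weight u q μ := by
  have := (PSp_pos hu hq huq (μ.colLen 0)).ne'
  rw [prod_transition hu hq huq (fun j => μ.colLen_anti _ _ (by omega))
    ((oddPartsEvenMult_iff μ).1 h), weight_eq hq, colLen_eq_zero hn, potential_zero,
    ← prod_subset (range_mono hn) fun j _ hj => by
      rw [mem_range, not_lt] at hj
      rw [colLen_eq_zero hj, colLen_eq_zero (by omega), columnWeight_zero]]
  field_simp

theorem prod_transition_colLen_eq_zero {μ : YoungDiagram} (u q : ℝ)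
    (h : ¬ OddPartsEvenMult μ) {n : ℕ} (hn : μ.rowLen 0 ≤ n) :
    ∏ j ∈ range n, transition u q j (μ.colLen j) (μ.colLen (j + 1)) = 0 := by
  rw [oddPartsEvenMult_iff] at h
  push Not at h
  obtain ⟨j, hj, h⟩ := h
  refine prod_eq_zero (i := j) ?_ (by rw [transition, if_pos hj, K₁, if_neg (fun h' => h h'.2)])
  rw [mem_range]
  by_contra hjn
  rw [colLen_eq_zero (by omega), colLen_eq_zero (by omega)] at h
  simp at h

theorem pathProb_initEven (hu : 0 < u) (hq : 1 < q) (huq : u ^ 2 < q) (μ : YoungDiagram) {n : ℕ}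
    (hn : μ.rowLen 0 ≤ n) : pathProb u q (initEven u q) μ.colLen n = Re u q μ := by
  rw [pathProb, Re, numParts_eq]
  by_cases he : Even (μ.colLen 0)
  · by_cases h : OddPartsEvenMult μ
    · rw [if_pos ⟨he, h⟩, initEven_of_even he, PO_even_eq hu hq he, mul_assoc,
        prod_transition_colLen hu hq huq μ h hn]
    · rw [if_neg (by tauto), prod_transition_colLen_eq_zero u q h hn, mul_zero]
  · rw [if_neg (by tauto), initEven]
    simp [he]

theorem pathProb_initOdd (hu : 0 < u) (hq : 1 < q) (huq : u ^ 2 < q) (μ : YoungDiagram) {n : ℕ}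
    (hn : μ.rowLen 0 ≤ n) : pathProb u q (initOdd u q) μ.colLen n = Ro u q μ := by
  rw [pathProb, Ro, numParts_eq]
  by_cases he : Odd (μ.colLen 0)
  · by_cases h : OddPartsEvenMult μ
    · rw [if_pos ⟨he, h⟩, initOdd_of_odd hu he, PO_odd_eq hu hq he,
        ← prod_transition_colLen hu hq huq μ h hn]
      field_simp
    · rw [if_neg (by tauto), prod_transition_colLen_eq_zero u q h hn, mul_zero]
  · rw [if_neg (by tauto), initOdd]
    simp [he]

end Telescoping

/-! ### From the chain to a random partition. -/

/-- An antitone sequence that vanishes eventually is the sequence of column lengths of a diagram. -/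
theorem exists_youngDiagram_colLen {f : ℕ → ℕ} (hf : Antitone f) {N : ℕ} (hN : f N = 0) :
    ∃ μ : YoungDiagram, ∀ j, f j = μ.colLen j := by
  -- The region below the graph of f lies in a finite box, so its cells form a `Finset`.
  have hmem : ∀ i j, i < f j → i < f 0 ∧ j < N := fun i j h => by
    refine ⟨h.trans_le (hf (Nat.zero_le j)), ?_⟩
    by_contra hj
    have := hf (not_lt.1 hj)
    omega
  let μ : YoungDiagram :=
    { cells := {c ∈ range (f 0) ×ˢ range N | c.1 < f c.2}
      isLowerSet := by
        rintro ⟨i, j⟩ ⟨i', j'⟩ ⟨hi, hj⟩ h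
        simp only [coe_filter, mem_product, mem_range, Set.mem_ofPred_eq] at h ⊢
        have := hf hj
        have hlt : i' < f j' := lt_of_le_of_lt hi (h.2.trans_le this)
        exact ⟨hmem _ _ hlt, hlt⟩ }
  refine ⟨μ, fun j => ?_⟩
  have key : ∀ i, i < f j ↔ i < μ.colLen j := fun i => by
    rw [← YoungDiagram.mem_iff_lt_colLen]
    change _ ↔ (i, j) ∈ ({c ∈ range (f 0) ×ˢ range N | c.1 < f c.2} : Finset (ℕ × ℕ))
    simp only [mem_filter, mem_product, mem_range]
    exact ⟨fun h => ⟨hmem i j h, h⟩, fun h => h.2⟩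
  have h1 := key (f j)
  have h2 := key (μ.colLen j)
  omega

section Chain

variable {Ω : Type*} [MeasurableSpace Ω] {P : Measure Ω}
  {u q : ℝ} {init : ℕ → ℝ} {X : ℕ → Ω → ℕ}

theorem IsAlternatingChain.prob_prefix (h : IsAlternatingChain P u q init X) (a : ℕ → ℕ) (n : ℕ) :
    P.real {ω | ∀ i ≤ n, X i ω = a i} = pathProb u q init a n := by
  induction n with
  | zero => simp [pathProb, h.start]
  | succ n ih =>
    have := h.step n a (a (n + 1))
    rw [ih] at this
    rw [pathProb, prod_range_succ, ← mul_assoc, ← pathProb, transition, ← this]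
    congr 1
    ext ω
    simp only [Set.mem_ofPred_eq, Nat.le_succ_iff, or_imp, forall_and, forall_eq]

variable [IsProbabilityMeasure P]

/-- Continuity from above: the event of following a whole sequence is the decreasing intersection of
its prefix events. -/
theorem IsAlternatingChain.tendsto_pathProb (h : IsAlternatingChain P u q init X) (a : ℕ → ℕ) :
    Tendsto (pathProb u q init a) atTop (𝓝 (P.real {ω | ∀ j, X j ω = a j})) := by
  have hmeas : ∀ n, MeasurableSet {ω | ∀ i ≤ n, X i ω = a i} := fun n => by
    have : {ω | ∀ i ≤ n, X i ω = a i} = ⋂ i ∈ Set.Iic n, X i ⁻¹' {a i} := by ext; simp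
    rw [this]
    exact MeasurableSet.biInter (Set.to_countable _) fun i _ =>
      h.measurable i (measurableSet_singleton _)
  have key := tendsto_measure_iInter_atTop (μ := P) (fun n => (hmeas n).nullMeasurableSet)
    (fun m n hmn ω hω i hi => hω i (hi.trans hmn)) ⟨0, measure_ne_top _ _⟩
  have hset : (⋂ n, {ω | ∀ i ≤ n, X i ω = a i}) = {ω | ∀ j, X j ω = a j} := by
    ext ω
    simp only [Set.mem_iInter, Set.mem_ofPred_eq]
    exact ⟨fun h j => h j j le_rfl, fun h n i _ => h i⟩
  rw [hset] at key
  have := (ENNReal.tendsto_toReal (measure_ne_top P _)).comp key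
  refine this.congr fun n => ?_
  rw [← h.prob_prefix a n]
  rfl

theorem IsAlternatingChain.measure_path_eq_zero_of_lt (h : IsAlternatingChain P u q init X)
    {a : ℕ → ℕ} {n : ℕ} (ha : a n < a (n + 1)) : P {ω | ∀ i ≤ n + 1, X i ω = a i} = 0 := by
  rw [← measureReal_eq_zero_iff, h.prob_prefix, pathProb, prod_range_succ, transition,
    K₁_eq_zero_of_lt ha, K₂_eq_zero_of_lt ha]
  simp

/-- Neither kernel allows an increase, so a prefix whose last step increases is null. There are
countably many prefixes of a given length, hence the exceptional set is null. -/
theorem IsAlternatingChain.ae_antitone (h : IsAlternatingChain P u q init X) :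
    ∀ᵐ ω ∂P, Antitone fun j => X j ω := by
  have key : ∀ n, ∀ᵐ ω ∂P, X (n + 1) ω ≤ X n ω := fun n => by
    have : ∀ s : Fin (n + 2) → ℕ, ∀ᵐ ω ∂P, (∀ i : Fin (n + 2), X i ω = s i) →
        X (n + 1) ω ≤ X n ω := fun s => by
      let a : ℕ → ℕ := fun i => if hi : i < n + 2 then s ⟨i, hi⟩ else 0
      by_cases ha : a n < a (n + 1)
      · have h0 := h.measure_path_eq_zero_of_lt ha
        filter_upwards [measure_eq_zero_iff_ae_notMem.1 h0] with ω hω hs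
        refine absurd (fun i hi => ?_) hω
        have hi' : i < n + 2 := by omega
        simpa [a, hi'] using hs ⟨i, hi'⟩
      · refine Eventually.of_forall fun ω hs => ?_
        have h1 := hs ⟨n, by omega⟩
        have h2 := hs ⟨n + 1, by omega⟩
        simp [a] at ha
        simp only at h1 h2
        omega
    filter_upwards [ae_all_iff.2 this] with ω hω
    exact hω (fun i => X i ω) fun _ => rfl
  filter_upwards [ae_all_iff.2 key] with ω hω
  exact antitone_nat_of_succ_le hω

/-- The row also gives positive mass to 0 ≠ a, so the mass at a is less than 1. -/
theorem K₂_self_ne_one (hu : 0 < u) (hq : 1 < q) (huq : u ^ 2 < q) {a : ℕ} (ha : a ≠ 0) :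
    K₂ u q a a ≠ 1 := by
  have h := isProbMass_K₂ hu hq huq a
  have h1 := sum_le_hasSum {a, 0} (fun b _ => h.1 b) h.2
  rw [sum_pair ha] at h1
  have := K₂_pos hu hq huq (Nat.zero_le a)
  intro h2
  linarith

/-- The limit M of the prefix probabilities is unchanged by one more step at c, so M = M · `K₂ u q c
c`, which forces M = 0. -/
theorem IsAlternatingChain.measure_stuck_eq_zero (h : IsAlternatingChain P u q init X)
    (hu : 0 < u) (hq : 1 < q) (huq : u ^ 2 < q) {a : ℕ → ℕ} {N c : ℕ} (hc : c ≠ 0)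
    (ha : ∀ j, N ≤ j → a j = c) : P {ω | ∀ j, X j ω = a j} = 0 := by
  rw [← measureReal_eq_zero_iff]
  have ht := h.tendsto_pathProb a
  set M := P.real {ω | ∀ j, X j ω = a j}
  -- Only the steps made with `K₂` are useful: `K₁` can hold a value with certainty, for instance
  -- K₁(1,1) = 1.
  have hodd : Tendsto (fun n : ℕ => 2 * n + 1) atTop atTop :=
    tendsto_atTop_mono (fun n => by simp only [id]; omega) tendsto_id
  have h1 := (ht.comp hodd).mul_const (K₂ u q c c)
  have h2 := ht.comp ((tendsto_add_atTop_nat 1).comp hodd)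
  have h3 : M * K₂ u q c c = M := by
    refine tendsto_nhds_unique h1 (h2.congr' ?_)
    filter_upwards [eventually_ge_atTop N] with n hn
    simp only [Function.comp_apply]
    rw [pathProb, prod_range_succ, ← mul_assoc, ← pathProb, transition,
      if_neg (Nat.not_even_iff_odd.2 (odd_two_mul_add_one n)), ha _ (by omega), ha _ (by omega)]
  have h4 := K₂_self_ne_one hu hq huq hc
  have h5 : M * (K₂ u q c c - 1) = 0 := by linarith
  exact (mul_eq_zero.1 h5).resolve_right (sub_ne_zero.2 h4)

theorem exists_eventually_const_of_antitone {f : ℕ → ℕ} (hf : Antitone f) :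
    ∃ N, ∀ j, N ≤ j → f j = f N := by
  obtain ⟨N, hN⟩ := Nat.sInf_mem (Set.range_nonempty f)
  exact ⟨N, fun j hj => (hf hj).antisymm (hN ▸ Nat.sInf_le (Set.mem_range_self j))⟩

theorem IsAlternatingChain.ae_exists_eq_zero (h : IsAlternatingChain P u q init X)
    (hu : 0 < u) (hq : 1 < q) (huq : u ^ 2 < q) : ∀ᵐ ω ∂P, ∃ N, X N ω = 0 := by
  have key : ∀ N (s : Fin (N + 1) → ℕ), ∀ᵐ ω ∂P, (∀ i : Fin (N + 1), X i ω = s i) →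
      (∀ j, N ≤ j → X j ω = X N ω) → X N ω = 0 := fun N s => by
    -- The sequence follows s and is frozen from N on. For each N there are countably many such
    -- sequences, so discarding the null events stays within a countable union.
    let a : ℕ → ℕ := fun i => if hi : i < N then s ⟨i, by omega⟩ else s ⟨N, by omega⟩
    by_cases hc : s ⟨N, by omega⟩ = 0
    · refine Eventually.of_forall fun ω hs _ => ?_
      rw [← hc]
      exact hs ⟨N, by omega⟩
    · have h0 := h.measure_stuck_eq_zero hu hq huq (a := a) (N := N) hc fun j hj => by
        simp [a, hj]
      filter_upwards [measure_eq_zero_iff_ae_notMem.1 h0] with ω hω hs hconst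
      refine absurd (fun j => ?_) hω
      by_cases hj : j < N
      · simpa [a, hj] using hs ⟨j, by omega⟩
      · rw [hconst j (by omega)]
        simpa [a, hj] using hs ⟨N, by omega⟩
  filter_upwards [h.ae_antitone, ae_all_iff.2 fun N => ae_all_iff.2 (key N)] with ω hω hkey
  obtain ⟨N, hN⟩ := exists_eventually_const_of_antitone hω
  exact ⟨N, hkey N (fun i => X i ω) (fun _ => rfl) hN⟩

/-- An antitone path that hits 0 is a column sequence. The law follows because the prefix
probabilities of a column sequence are constant once all nonempty columns are exhausted. -/
theorem IsAlternatingChain.partitionHasLaw (h : IsAlternatingChain P u q init X)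
    (hu : 0 < u) (hq : 1 < q) (huq : u ^ 2 < q) {R : YoungDiagram → ℝ}
    (hR : ∀ (μ : YoungDiagram) (n : ℕ), μ.rowLen 0 ≤ n → pathProb u q init μ.colLen n = R μ) :
    PartitionHasLaw P X R := by
  constructor
  · filter_upwards [h.ae_antitone, h.ae_exists_eq_zero hu hq huq] with ω hω ⟨N, hN⟩
    exact exists_youngDiagram_colLen hω hN
  · exact fun μ => tendsto_nhds_unique (h.tendsto_pathProb μ.colLen)
      (tendsto_atTop_of_eventually_const (hR μ))

end Chain

end

end RandomPartition

theorem mainTheorem11 (q : ℕ) (hq : IsPrimePow q) (u : ℝ) (hu : 0 < u) (huq : u < √(q : ℝ)) :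
    (∀ a, RandomPartition.IsProbMass (RandomPartition.K₁ u q a)) ∧
    (∀ a, RandomPartition.IsProbMass (RandomPartition.K₂ u q a)) ∧
    RandomPartition.IsProbMass (RandomPartition.initEven u q) ∧
    RandomPartition.IsProbMass (RandomPartition.initOdd u q) ∧
    (∀ (Ω : Type*) [MeasurableSpace Ω] (P : MeasureTheory.Measure Ω)
      [MeasureTheory.IsProbabilityMeasure P] (X : ℕ → Ω → ℕ),
      RandomPartition.IsAlternatingChain P u q (RandomPartition.initEven u q) X →
        RandomPartition.PartitionHasLaw P X (RandomPartition.Re u q)) ∧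
    (∀ (Ω : Type*) [MeasurableSpace Ω] (P : MeasureTheory.Measure Ω)
      [MeasureTheory.IsProbabilityMeasure P] (X : ℕ → Ω → ℕ),
      RandomPartition.IsAlternatingChain P u q (RandomPartition.initOdd u q) X →
        RandomPartition.PartitionHasLaw P X (RandomPartition.Ro u q)) := by
  have hq1 : (1 : ℝ) < q := by exact_mod_cast hq.one_lt
  have huq2 : u ^ 2 < q := (Real.lt_sqrt hu.le).1 huq
  exact ⟨RandomPartition.isProbMass_K₁ hu hq1 huq2, RandomPartition.isProbMass_K₂ hu hq1 huq2,
    RandomPartition.isProbMass_initEven hu hq1 huq2, RandomPartition.isProbMass_initOdd hu hq1 huq2,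
    fun _ _ _ _ _ h => h.partitionHasLaw hu hq1 huq2 fun μ _ hn =>
      RandomPartition.pathProb_initEven hu hq1 huq2 μ hn,
    fun _ _ _ _ _ h => h.partitionHasLaw hu hq1 huq2 fun μ _ hn =>
      RandomPartition.pathProb_initOdd hu hq1 huq2 μ hn⟩
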